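/- Let $\emptyset=K_0\subseteq K_1\subseteq\dots\subseteq K_N$ be simplicial complexes (sets of nonempty finite subsets, called simplices, of a vertex set, closed under passing to nonempty subsets) with $K_i\setminus K_{i-1}=\{\sigma_i\}$ for $1\le i\le N$. Let $d_i=\#\sigma_i-1$ be the dimension of $\sigma_i$, and let $D$ be the boundary matrix, i.e. the $N\times N$ matrix over $\mathbb Z_2$ with $D^i_j=1$ (row $i$, column $j$) if $\sigma_i\subset\sigma_j$ and $d_j=d_i+1$, and $D^i_j=0$ otherwise. For a matrix $M$ let $M_j$ be its $j$-th column and, if $M_j\neq0$, let $\mathrm{low}(M_j)$ (the pivot of $M_j$) be the largest index of a nonzero entry of $M_j$. Pairs: let $M$ be any reduced matrix (nonzero columns have pairwise distinct pivots) obtained from $D$ by finitely many left-to-right column additions (adding $M_i$ to $M_j$ with $i<j$). Let $P=\{(i,j): M_j\ne 0,\ i=\mathrm{low}(M_j)\}$ be the set of pivot pairs. An index is essential if it occurs in no pivot pair, neither as first nor as second entry. Put $\overline P=P\cup\{(i,N+1): i \text{ essential}\}$. Algorithm (retrospective reduction of $D$): start with $R=D$ and an empty partial array $Q$. For $j=1,\dots,N$: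 set to $0$ all entries of $R_j$ in negative rows, i.e. in rows $i$ that occur as a value of $Q$; then call $\mathrm{Reduce}(j)$. The procedure $\mathrm{Reduce}(j)$ is: an entry $R_j^\ell\neq0$ is called paired if $Q[\ell]$ is defined and $Q[\ell]\ne j$; while $R_j$ has a paired entry, let $\ell$ be the largest index of such an entry, put $m=Q[\ell]$, call $\mathrm{Reduce}(m)$, and then add the resulting column $R_m$ to $R_j$; when there is no paired entry left and $R_j\ne0$, set $Q[\mathrm{low}(R_j)]\gets j$. The number of bitflips caused by the addition of $R_m$ to $R_j$ is the number of nonzero entries of $R_m$ at that moment, and the total number of bitflips is the sum over all column additions that are executed, those in recursive calls included. Claim: the algorithm terminates, and its total number of bitflips is at most $$\sum_{(i,j)\in\overline P}(j-i)^2+\sum_{k=1}^N(d_k+1).$$ -/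

import Mathlib

/-! ## Matrix reduction over `ℤ/2` -/

/-- The pivot of column `j` of `M`: the largest row index of a nonzero entry, `⊥` if the column
is zero. -/
def low {N : ℕ} (M : Matrix (Fin N) (Fin N) (ZMod 2)) (j : Fin N) : WithBot (Fin N) :=
  (Finset.univ.filter fun i => M i j ≠ 0).max

/-- The number of nonzero entries of column `j` of `M`. -/
def colSize {N : ℕ} (M : Matrix (Fin N) (Fin N) (ZMod 2)) (j : Fin N) : ℕ :=
  (Finset.univ.filter fun i => M i j ≠ 0).card

/-- The result of adding column `m` of `M` to column `j`. -/
def addColumn {N : ℕ} (M : Matrix (Fin N) (Fin N) (ZMod 2)) (m j : Fin N) :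
    Matrix (Fin N) (Fin N) (ZMod 2) :=
  M.updateCol j fun i => M i j + M i m

/-- `M'` arises from `M` by one left-to-right column operation. -/
def LeftToRightStep {N : ℕ} (M M' : Matrix (Fin N) (Fin N) (ZMod 2)) : Prop :=
  ∃ m j : Fin N, m < j ∧ M' = addColumn M m j

/-- A matrix is reduced if its nonzero columns have pairwise distinct pivots. -/
def IsReducedMatrix {N : ℕ} (M : Matrix (Fin N) (Fin N) (ZMod 2)) : Prop :=
  ∀ j j' : Fin N, low M j ≠ ⊥ → low M j = low M j' → j = j'

/-- `R` is a reduced matrix obtained from `D` by finitely many left-to-right column operations. -/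
def IsReductionOf {N : ℕ} (D R : Matrix (Fin N) (Fin N) (ZMod 2)) : Prop :=
  Relation.ReflTransGen LeftToRightStep D R ∧ IsReducedMatrix R

/-! ## Simplexwise filtrations and their pairs -/

/-- A simplexwise filtered simplicial complex `∅ = K₀ ⊆ K₁ ⊆ ⋯ ⊆ K_N` in which exactly one simplex
is added at each step. Indices of simplices start at `0`, so `simplex i` is the simplex which is
added in passing from `complex i` to `complex (i + 1)`. -/
structure SimplexwiseFiltration (V : Type*) (N : ℕ) where
  complex : Fin (N + 1) → PreAbstractSimplicialComplex V
  simplex : Fin N → Finset V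
  faces_zero : (complex 0).faces = ∅
  mono : ∀ i : Fin N, (complex i.castSucc).faces ⊆ (complex i.succ).faces
  faces_diff : ∀ i : Fin N,
    (complex i.succ).faces \ (complex i.castSucc).faces = {simplex i}

namespace SimplexwiseFiltration

variable {V : Type*} {N : ℕ}

/-- The dimension of the `k`-th simplex (simplices are nonempty, so nothing is truncated). -/
def dim (F : SimplexwiseFiltration V N) (k : Fin N) : ℕ := (F.simplex k).card - 1

/-- The boundary matrix: the entry `(i, j)` is `1` if the `i`-th simplex is a facet of the `j`-th
one, and `0` otherwise. -/
def boundaryMatrix [DecidableEq V] (F : SimplexwiseFiltration V N) :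
    Matrix (Fin N) (Fin N) (ZMod 2) :=
  Matrix.of fun i j =>
    if F.simplex i ⊆ F.simplex j ∧ (F.simplex j).card = (F.simplex i).card + 1 then 1 else 0

end SimplexwiseFiltration

/-- `(i, j)` is a pivot pair of the reduced matrix `R`. -/
def IsPivotPair {N : ℕ} (R : Matrix (Fin N) (Fin N) (ZMod 2)) (i j : Fin N) : Prop :=
  low R j = (i : WithBot (Fin N))

/-- The index `i` is essential: it is neither the first nor the second entry of a pivot pair. -/
def IsEssential {N : ℕ} (R : Matrix (Fin N) (Fin N) (ZMod 2)) (i : Fin N) : Prop :=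
  ∀ j : Fin N, ¬ IsPivotPair R i j ∧ ¬ IsPivotPair R j i

open Classical in
/-- The pivot pairs `(i, j)`, together with the pairs `(i, ∞)` for essential `i`, where the extra
index `∞` is the one that follows all column indices. -/
noncomputable def extendedPairs {N : ℕ} (R : Matrix (Fin N) (Fin N) (ZMod 2)) :
    Finset (Fin N × Fin (N + 1)) :=
  Finset.univ.filter fun p =>
    (∃ j : Fin N, p.2 = j.castSucc ∧ IsPivotPair R p.1 j) ∨
      (p.2 = Fin.last N ∧ IsEssential R p.1)

/-! ## The retrospective reduction -/

namespace Retrospective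

/-- The global state of the algorithm: the current matrix `R`, the partial array `P` of the pivots
found so far (`P i = some j` if `(i, j)` has been recorded), and the number of bitflips so far. -/
structure State (N : ℕ) where
  R : Matrix (Fin N) (Fin N) (ZMod 2)
  P : Fin N → Option (Fin N)
  bitflips : ℕ

variable {N : ℕ}

/-- The nonzero entry of column `j` in row `i` is paired with a column `m` other than `j` itself
(the pivot of a column that has been recorded for this very column is not to be eliminated). -/
def State.PairedWith (s : State N) (j i m : Fin N) : Prop :=
  s.R i j ≠ 0 ∧ s.P i = some m ∧ m ≠ j

/-- Add column `m` to column `j`; every nonzero entry of column `m` causes one bitflip. -/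
def State.add (s : State N) (m j : Fin N) : State N where
  R := addColumn s.R m j
  P := s.P
  bitflips := s.bitflips + colSize s.R m

/-- If column `j` is nonzero, record `j` as the column with its pivot: `P[low R_j] ← j`. -/
def State.record (s : State N) (j : Fin N) : State N where
  R := s.R
  P := fun i => if low s.R j = (i : WithBot (Fin N)) then some j else s.P i
  bitflips := s.bitflips

open Classical in
/-- Remove from column `j` the entries in negative rows, i.e. in rows `i` such that a pivot of
column `i` has been recorded. -/
noncomputable def State.removeNegative (s : State N) (j : Fin N) : State N where
  R := s.R.updateCol j fun i => if ∃ l, s.P l = some i then 0 else s.R i j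
  P := s.P
  bitflips := s.bitflips

/-- `Reduce j s s'`: the procedure `Reduce(j)`, called in state `s`, terminates in state `s'`.
* `done` (the while loop ends): no entry of column `j` is paired, and the pivot is recorded.
* `step` (one pass through the while loop, then the rest of the call): `l` is the largest index of a
  paired entry of column `j` and `m = P[l]`; the recursive call `Reduce(m)` leads from `s` to `s₁`,
  then column `m` is added to column `j`, and the loop goes on until the call ends in `s'`. -/
inductive Reduce : Fin N → State N → State N → Prop
  | done (j : Fin N) (s : State N) (h : ∀ i m, ¬ s.PairedWith j i m) :
      Reduce j s (s.record j)
  | step (j l m : Fin N) (s s₁ s' : State N) (hl : s.PairedWith j l m)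
      (hmax : ∀ i m', s.PairedWith j i m' → i ≤ l)
      (hcall : Reduce m s s₁) (hloop : Reduce j (s₁.add m j) s') :
      Reduce j s s'

/-- The for loop of the main procedure over a list of column indices, from state `s` to `s'`. -/
inductive Loop : List (Fin N) → State N → State N → Prop
  | nil (s : State N) : Loop [] s s
  | cons (j : Fin N) (js : List (Fin N)) (s s₁ s' : State N)
      (hred : Reduce j (s.removeNegative j) s₁) (hloop : Loop js s₁ s') :
      Loop (j :: js) s s'

/-- `Main D s`: the retrospective reduction of `D` terminates in state `s`. -/
def Main (D : Matrix (Fin N) (Fin N) (ZMod 2)) (s : State N) : Prop :=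
  Loop (List.finRange N) ⟨D, fun _ => none, 0⟩ s

end Retrospective

/-! ## Pivots of vectors over `ℤ/2` -/

/-! Fix any reduction `M` of the boundary matrix `D`. Call row `e` positive if `M` has a zero column
`e`, and negative otherwise.

Correctness. Since `D * D = 0`, every combination of columns of `D` is a cycle, and the pivot of a
cycle is positive. Deleting negative rows (`killNegative`) therefore preserves pivots. When column
`j` has no paired entry left, its pivot is that of column `j` of `M` (`IsReductionOf.isLow_iff`), so
the array always records exactly the pivots of the processed columns of `M`.

Amortization. After its call, column `m` meets recorded rows only in its own pivot row `l`. Adding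
it to column `j` clears entry `(l, j)`, and no later addition restores it (`Inv.settled_add`). So
each ordered pair `(m, j)` is added at most once, and the bitflips are bounded by the sum of
`additionCost` over all pairs.

Counting. An entry `e` of the added column is positive, and if `f` is its partner (`N` if unpaired),
then `m` and `j` lie in `(e, f]`. The only exception is the pivot of `m`, which may already be
paired before `j`; it is then an original entry of column `j` of `D` (`Inv.colSize_le`). Exchanging
sums, row `e` contributes at most `(f - e)^2`, while the exceptions number at most the nonzero
entries of `D`, that is, `dim + 1` per column.

Termination. Recursive calls go to strictly smaller pivots, and each pass through the loop removes a
paired entry without creating one. -/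

/-- `i` is the largest index of a nonzero entry of `v`. -/
def IsLow {N : ℕ} (v : Fin N → ZMod 2) (i : Fin N) : Prop :=
  v i ≠ 0 ∧ ∀ e, i < e → v e = 0

section LinearAlgebra

variable {N : ℕ}

theorem ZMod.two_add_eq_zero_of_ne_zero {x y : ZMod 2} (hx : x ≠ 0) (hy : y ≠ 0) : x + y = 0 := by
  revert x y; decide

theorem IsLow.eq {v : Fin N → ZMod 2} {i k : Fin N} (hi : IsLow v i) (hk : IsLow v k) : i = k := by
  rcases lt_trichotomy i k with h | h | h
  · exact absurd (hi.2 _ h) hk.1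
  · exact h
  · exact absurd (hk.2 _ h) hi.1

theorem IsLow.ne_zero {v : Fin N → ZMod 2} {i : Fin N} (hi : IsLow v i) : v ≠ 0 :=
  fun h => hi.1 (by simp [h])

theorem IsLow.le {v : Fin N → ZMod 2} {i e : Fin N} (hi : IsLow v i) (he : v e ≠ 0) : e ≤ i :=
  not_lt.1 fun h => he (hi.2 _ h)

theorem exists_isLow {v : Fin N → ZMod 2} (hv : v ≠ 0) : ∃ i, IsLow v i := by
  classical
  have hne : (Finset.univ.filter fun i => v i ≠ 0).Nonempty := by
    obtain ⟨i, hi⟩ := Function.ne_iff.1 hv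
    exact ⟨i, by simpa using hi⟩
  refine ⟨_, (Finset.mem_filter.1 (Finset.max'_mem _ hne)).2, fun e he => ?_⟩
  by_contra h
  exact absurd (Finset.le_max' _ e (by simpa using h)) (not_le.2 he)

theorem IsLow.add_of_lt {u v : Fin N → ZMod 2} {i k : Fin N} (hu : IsLow u i) (hv : IsLow v k)
    (h : i < k) : IsLow (u + v) k :=
  ⟨by simpa [hu.2 _ h] using hv.1, fun e he => by simp [hu.2 _ (h.trans he), hv.2 _ he]⟩

theorem low_eq_coe_iff (M : Matrix (Fin N) (Fin N) (ZMod 2)) (i j : Fin N) :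
    low M j = (i : WithBot (Fin N)) ↔ IsLow (M.transpose j) i := by
  unfold low IsLow
  constructor
  · intro h
    refine ⟨(Finset.mem_filter.1 (Finset.mem_of_max h)).2, fun e he => ?_⟩
    by_contra hne
    have := Finset.le_max (s := Finset.univ.filter fun i => M i j ≠ 0) (a := e)
      (by simpa using hne)
    rw [h] at this
    exact absurd (WithBot.coe_le_coe.1 this) (not_le.2 he)
  · rintro ⟨h, h'⟩
    refine le_antisymm (Finset.max_le fun e he => ?_) (Finset.le_max (by simpa using h))
    exact WithBot.coe_le_coe.2 (not_lt.1 fun hlt => (Finset.mem_filter.1 he).2 (h' e hlt))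

theorem IsReducedMatrix.eq_of_isLow {M : Matrix (Fin N) (Fin N) (ZMod 2)} (hM : IsReducedMatrix M)
    {i j k : Fin N} (hj : IsLow (M.transpose j) i) (hk : IsLow (M.transpose k) i) : j = k := by
  rw [← low_eq_coe_iff] at hj hk
  exact hM j k (by simp [hj]) (hj.trans hk.symm)

/-- The span of the columns of `M` with index less than `t`. -/
def spanLT (M : Matrix (Fin N) (Fin N) (ZMod 2)) (t : ℕ) : Submodule (ZMod 2) (Fin N → ZMod 2) :=
  Submodule.span (ZMod 2) {v | ∃ j : Fin N, (j : ℕ) < t ∧ M.transpose j = v}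

theorem spanLT_mono (M : Matrix (Fin N) (Fin N) (ZMod 2)) {t u : ℕ} (h : t ≤ u) :
    spanLT M t ≤ spanLT M u :=
  Submodule.span_mono fun _ ⟨j, hj, hv⟩ => ⟨j, lt_of_lt_of_le hj h, hv⟩

theorem transpose_mem_spanLT (M : Matrix (Fin N) (Fin N) (ZMod 2)) {t : ℕ} {j : Fin N}
    (h : (j : ℕ) < t) : M.transpose j ∈ spanLT M t :=
  Submodule.subset_span ⟨j, h, rfl⟩

/-- Distinct pivots cannot cancel: the pivot of a sum of vectors with different pivots is the larger
one. -/
theorem IsReducedMatrix.exists_isLow_of_mem_spanLT {M : Matrix (Fin N) (Fin N) (ZMod 2)}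
    (hM : IsReducedMatrix M) {t : ℕ} {v : Fin N → ZMod 2} {i : Fin N} (hv : v ∈ spanLT M t)
    (hi : IsLow v i) : ∃ j : Fin N, (j : ℕ) < t ∧ IsLow (M.transpose j) i := by
  induction t generalizing v i with
  | zero => exact absurd (by simpa [spanLT] using hv) hi.ne_zero
  | succ t ih =>
    have old : ∀ {v i}, v ∈ spanLT M t → IsLow v i →
        ∃ j : Fin N, (j : ℕ) < t + 1 ∧ IsLow (M.transpose j) i := fun hv hi => by
      obtain ⟨j, hj, h⟩ := ih hv hi
      exact ⟨j, by omega, h⟩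
    by_cases ht : t < N
    · have hset : {v | ∃ j : Fin N, (j : ℕ) < t + 1 ∧ M.transpose j = v} =
          insert (M.transpose ⟨t, ht⟩) {v | ∃ j : Fin N, (j : ℕ) < t ∧ M.transpose j = v} := by
        ext v
        constructor
        · rintro ⟨j, hj, rfl⟩
          rcases Nat.lt_succ_iff_lt_or_eq.1 hj with hj | hj
          · exact Or.inr ⟨j, hj, rfl⟩
          · exact Or.inl (congrArg M.transpose (Fin.ext hj))
        · rintro (rfl | ⟨j, hj, rfl⟩)
          · exact ⟨_, Nat.lt_succ_self t, rfl⟩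
          · exact ⟨j, by omega, rfl⟩
      rw [spanLT, hset, Submodule.mem_span_insert] at hv
      obtain ⟨c, u, hu, rfl⟩ := hv
      change u ∈ spanLT M t at hu
      have hc : c = 0 ∨ c = 1 := by clear hi; revert c; decide
      rcases hc with rfl | rfl
      · exact old hu (by simpa using hi)
      rw [one_smul] at hi
      by_cases h0 : M.transpose ⟨t, ht⟩ = 0
      · exact old hu (by simpa [h0] using hi)
      by_cases hu0 : u = 0
      · exact ⟨⟨t, ht⟩, by simp, by simpa [hu0] using hi⟩
      obtain ⟨a, ha⟩ := exists_isLow h0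
      obtain ⟨b, hb⟩ := exists_isLow hu0
      rcases lt_trichotomy a b with h | rfl | h
      · rw [hi.eq (ha.add_of_lt hb h)]
        exact old hu hb
      · obtain ⟨j, hj, hjb⟩ := ih hu hb
        have := hM.eq_of_isLow ha hjb
        subst this
        exact absurd hj (lt_irrefl _)
      · rw [add_comm] at hi
        rw [hi.eq (hb.add_of_lt ha h)]
        exact ⟨_, by simp, ha⟩
    · refine old ?_ hi
      refine Submodule.span_mono ?_ hv
      rintro _ ⟨j, -, rfl⟩
      exact ⟨j, by have := j.2; omega, rfl⟩

/-! ### Column operations and spans of initial columns. -/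

theorem transpose_addColumn_self (M : Matrix (Fin N) (Fin N) (ZMod 2)) (m j : Fin N) :
    (addColumn M m j).transpose j = M.transpose j + M.transpose m := by
  ext i; simp [addColumn]

theorem transpose_addColumn_of_ne (M : Matrix (Fin N) (Fin N) (ZMod 2)) {m j k : Fin N}
    (h : k ≠ j) : (addColumn M m j).transpose k = M.transpose k := by
  ext i; simp [addColumn, h]

theorem sub_mem_spanLT_of_reflTransGen {D M : Matrix (Fin N) (Fin N) (ZMod 2)}
    (h : Relation.ReflTransGen LeftToRightStep D M) (j : Fin N) :
    M.transpose j - D.transpose j ∈ spanLT D j := by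
  induction h generalizing j with
  | refl => simp
  | tail _ hstep ih =>
    obtain ⟨m, k, hmk, rfl⟩ := hstep
    by_cases hj : j = k
    · subst hj
      rw [transpose_addColumn_self, add_sub_right_comm]
      refine add_mem (ih j) ?_
      rw [← sub_add_cancel (Matrix.transpose _ m) (D.transpose m)]
      exact add_mem (spanLT_mono D hmk.le (ih m)) (transpose_mem_spanLT D hmk)
    · rw [transpose_addColumn_of_ne _ hj]
      exact ih j

theorem IsReductionOf.spanLT_eq {D M : Matrix (Fin N) (Fin N) (ZMod 2)} (h : IsReductionOf D M)
    (t : ℕ) : spanLT M t = spanLT D t := by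
  apply le_antisymm
  · rw [spanLT, Submodule.span_le]
    rintro _ ⟨j, hj, rfl⟩
    rw [← sub_add_cancel (M.transpose j) (D.transpose j)]
    exact add_mem (spanLT_mono D (le_of_lt hj) (sub_mem_spanLT_of_reflTransGen h.1 j))
      (transpose_mem_spanLT D hj)
  · induction t with
    | zero =>
      rw [spanLT, Submodule.span_le]
      rintro _ ⟨j, hj, rfl⟩
      exact absurd hj (Nat.not_lt_zero _)
    | succ t ih =>
      rw [spanLT, Submodule.span_le]
      rintro _ ⟨j, hj, rfl⟩
      rw [← sub_sub_cancel (M.transpose j) (D.transpose j)]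
      refine sub_mem (transpose_mem_spanLT M hj) (spanLT_mono M (Nat.le_succ t) (ih ?_))
      exact spanLT_mono D (Nat.le_of_lt_succ hj) (sub_mem_spanLT_of_reflTransGen h.1 j)

/-! ### Cycles and the deletion of negative rows. -/

open Classical in
/-- The projection which deletes the entries in the rows `i` such that column `i` of `M` is
nonzero. -/
noncomputable def killNegative (M : Matrix (Fin N) (Fin N) (ZMod 2)) :
    (Fin N → ZMod 2) →ₗ[ZMod 2] (Fin N → ZMod 2) where
  toFun v := fun i => if M.transpose i = 0 then v i else 0
  map_add' u v := by ext i; by_cases h : M.transpose i = 0 <;> simp [h]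
  map_smul' c v := by ext i; by_cases h : M.transpose i = 0 <;> simp [h]

theorem killNegative_apply_of_eq_zero {M : Matrix (Fin N) (Fin N) (ZMod 2)} {i : Fin N}
    (h : M.transpose i = 0) (v : Fin N → ZMod 2) : killNegative M v i = v i := by
  simp [killNegative, h]

theorem killNegative_apply_of_ne_zero {M : Matrix (Fin N) (Fin N) (ZMod 2)} {i : Fin N}
    (h : M.transpose i ≠ 0) (v : Fin N → ZMod 2) : killNegative M v i = 0 := by
  simp [killNegative, h]

theorem mulVec_eq_zero_of_mem_spanLT {D : Matrix (Fin N) (Fin N) (ZMod 2)} (hD : D * D = 0)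
    {t : ℕ} {v : Fin N → ZMod 2} (hv : v ∈ spanLT D t) : D.mulVec v = 0 := by
  have : spanLT D t ≤ LinearMap.ker D.mulVecLin := by
    rw [spanLT, Submodule.span_le]
    rintro _ ⟨j, -, rfl⟩
    ext i
    exact congrFun (congrFun hD i) j
  exact this hv

/-- The pivot of a cycle is the index of a column which reduces to zero. -/
theorem IsReductionOf.transpose_eq_zero_of_isLow {D M : Matrix (Fin N) (Fin N) (ZMod 2)}
    (h : IsReductionOf D M) {v : Fin N → ZMod 2} (hv : D.mulVec v = 0) {i : Fin N}
    (hi : IsLow v i) : M.transpose i = 0 := by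
  by_contra hne
  have hvi : v i = 1 := by
    have := hi.1
    revert this
    generalize v i = x
    revert x
    decide
  -- In the relation `D.mulVec v = 0` the last column occurring is `i`, so it can be solved for.
  have hmem : D.transpose i ∈ spanLT D i := by
    rw [Matrix.mulVec_eq_sum, ← Finset.add_sum_erase _ _ (Finset.mem_univ i), hvi] at hv
    simp only [MulOpposite.op_one, one_smul] at hv
    rw [eq_neg_of_add_eq_zero_left hv]
    refine neg_mem (sum_mem fun k hk => ?_)
    rcases lt_or_gt_of_ne (Finset.ne_of_mem_erase hk) with hlt | hgt
    · rw [op_smul_eq_smul]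
      exact Submodule.smul_mem _ _ (transpose_mem_spanLT D hlt)
    · simp [hi.2 _ hgt]
  have hM : M.transpose i ∈ spanLT M i := by
    rw [h.spanLT_eq, ← sub_add_cancel (M.transpose i) (D.transpose i)]
    exact add_mem (sub_mem_spanLT_of_reflTransGen h.1 i) hmem
  obtain ⟨k, hk⟩ := exists_isLow hne
  obtain ⟨j, hj, hjk⟩ := h.2.exists_isLow_of_mem_spanLT hM hk
  rw [h.2.eq_of_isLow hjk hk] at hj
  exact lt_irrefl _ hj

/-- Elements of the span are cycles, so their pivot row is positive and survives the projection. -/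
theorem IsReductionOf.isLow_killNegative {D M : Matrix (Fin N) (Fin N) (ZMod 2)}
    (hD : D * D = 0) (h : IsReductionOf D M) {t : ℕ} {v : Fin N → ZMod 2} (hv : v ∈ spanLT D t)
    {i : Fin N} (hi : IsLow v i) : IsLow (killNegative M v) i := by
  refine ⟨?_, fun e he => ?_⟩
  · rw [killNegative_apply_of_eq_zero
      (h.transpose_eq_zero_of_isLow (mulVec_eq_zero_of_mem_spanLT hD hv) hi)]
    exact hi.1
  · by_cases h0 : M.transpose e = 0
    · rw [killNegative_apply_of_eq_zero h0, hi.2 e he]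
    · exact killNegative_apply_of_ne_zero h0 v

theorem IsReductionOf.exists_isLow_of_mem_map {D M : Matrix (Fin N) (Fin N) (ZMod 2)}
    (hD : D * D = 0) (h : IsReductionOf D M) {t : ℕ} {x : Fin N → ZMod 2}
    (hx : x ∈ (spanLT D t).map (killNegative M)) {i : Fin N} (hi : IsLow x i) :
    ∃ j : Fin N, (j : ℕ) < t ∧ IsLow (M.transpose j) i := by
  obtain ⟨y, hy, rfl⟩ := hx
  have hy0 : y ≠ 0 := by
    rintro rfl
    exact hi.ne_zero (map_zero _)
  obtain ⟨k, hk⟩ := exists_isLow hy0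
  rw [hi.eq (h.isLow_killNegative hD hy hk)]
  exact h.2.exists_isLow_of_mem_spanLT (by rwa [h.spanLT_eq]) hk

/-- A fully reduced representative of column `j`, with the negative rows deleted, has the same
pivot as column `j` of every reduction. -/
theorem IsReductionOf.isLow_iff {D M : Matrix (Fin N) (Fin N) (ZMod 2)}
    (hD : D * D = 0) (h : IsReductionOf D M) {j : Fin N} {x : Fin N → ZMod 2}
    (hx : x - killNegative M (D.transpose j) ∈ (spanLT D j).map (killNegative M))
    (hun : ∀ i, x i ≠ 0 → ∀ m : Fin N, m < j → ¬ IsLow (M.transpose m) i) (i : Fin N) :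
    IsLow x i ↔ IsLow (M.transpose j) i := by
  have hM : M.transpose j ∈ spanLT D (j + 1) := by
    rw [← h.spanLT_eq]
    exact transpose_mem_spanLT M (Nat.lt_succ_self _)
  have hlow : ∀ k, IsLow (M.transpose j) k → IsLow (killNegative M (M.transpose j)) k :=
    fun k hk => h.isLow_killNegative hD hM hk
  have hz : x - killNegative M (M.transpose j) ∈ (spanLT D j).map (killNegative M) := by
    have := sub_mem hx (Submodule.mem_map_of_mem (f := killNegative M)
      (sub_mem_spanLT_of_reflTransGen h.1 j))
    rwa [map_sub, sub_sub_sub_cancel_right] at this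
  set y := killNegative M (M.transpose j) with hy
  have back : ∀ k, IsLow y k → IsLow (M.transpose j) k := fun k hk => by
    have h0 : M.transpose j ≠ 0 := fun h0 => hk.ne_zero (by rw [hy, h0, map_zero])
    obtain ⟨k', hk'⟩ := exists_isLow h0
    rwa [hk.eq (hlow k' hk')]
  by_cases hxy : x - y = 0
  · rw [sub_eq_zero.1 hxy]
    exact ⟨back i, hlow i⟩
  obtain ⟨k, hk⟩ := exists_isLow hxy
  obtain ⟨m, hm, hmk⟩ := h.exists_isLow_of_mem_map hD hz hk
  have hxk : x k = 0 := by
    -- The pivot `k` of `x - y` is the pivot of an earlier column, where `x` has no entry. So `y`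
    -- has one; the pivot of `y`, not being that of an earlier column, exceeds `k`, and there `x`
    -- and `y` agree.
    by_contra hne
    exact hun k hne m hm hmk
  have hyk : y k ≠ 0 := by
    have := hk.1
    simpa [hxk] using this
  have agree : ∀ e, k < e → x e = y e := fun e he => sub_eq_zero.1 (hk.2 e he)
  have key : ∀ a, IsLow y a → IsLow x a := fun a ha => by
    have hka : k < a := by
      refine lt_of_le_of_ne (ha.le hyk) ?_
      rintro rfl
      have := h.2.eq_of_isLow hmk (back _ ha)
      subst this
      exact lt_irrefl _ hm
    exact ⟨by rw [agree a hka]; exact ha.1, fun e he => by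
      rw [agree e (hka.trans he)]; exact ha.2 e he⟩
  constructor
  · intro hi
    obtain ⟨a, ha⟩ := exists_isLow (v := y) fun h0 => hyk (by simp [h0])
    rw [hi.eq (key a ha)]
    exact back a ha
  · exact fun hi => key i (hlow i hi)

end LinearAlgebra


/-! ## Invariants of the retrospective reduction -/

namespace Retrospective

variable {N : ℕ}

open Classical in
/-- A bound on the number of bitflips which an addition of column `m` to column `j` can cause: one
for every row `e` which is not negative and whose pair `(e, f)` satisfies `e < m, j ≤ f`, and one
more if the pivot of column `m` is an entry of column `j` of `D`. -/
noncomputable def additionCost (D M : Matrix (Fin N) (Fin N) (ZMod 2)) (p : Fin N × Fin N) : ℕ :=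
  (Finset.univ.filter fun e => M.transpose e = 0 ∧ e < p.1 ∧ e < p.2 ∧
    ∀ k, IsLow (M.transpose k) e → p.1 ≤ k ∧ p.2 ≤ k).card +
  if ∃ l, IsLow (M.transpose p.1) l ∧ D l p.2 ≠ 0 then 1 else 0

/-- Column `p.1` is recorded with a pivot row in which column `p.2` has no entry. -/
def State.Settled (s : State N) (p : Fin N × Fin N) : Prop :=
  ∃ l, s.P l = some p.1 ∧ s.R l p.2 = 0

open Classical in
/-- The sum of the costs of all additions which have become impossible. -/
noncomputable def State.settledCost (D M : Matrix (Fin N) (Fin N) (ZMod 2)) (s : State N) : ℕ :=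
  ∑ p ∈ Finset.univ.filter s.Settled, additionCost D M p

theorem State.settledCost_mono (D M : Matrix (Fin N) (Fin N) (ZMod 2)) {s s' : State N}
    (h : ∀ p, s.Settled p → s'.Settled p) : s.settledCost D M ≤ s'.settledCost D M :=
  Finset.sum_le_sum_of_subset fun p hp => by
    simp only [Finset.mem_filter, Finset.mem_univ, true_and] at hp ⊢
    exact h p hp

theorem State.settledCost_add_le (D M : Matrix (Fin N) (Fin N) (ZMod 2)) {s s' : State N}
    (h : ∀ p, s.Settled p → s'.Settled p) {q : Fin N × Fin N} (hq : ¬ s.Settled q)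
    (hq' : s'.Settled q) : s.settledCost D M + additionCost D M q ≤ s'.settledCost D M := by
  classical
  unfold State.settledCost
  rw [add_comm, ← Finset.sum_insert (by simpa using hq)]
  refine Finset.sum_le_sum_of_subset fun p hp => ?_
  simp only [Finset.mem_insert, Finset.mem_filter, Finset.mem_univ, true_and] at hp ⊢
  rcases hp with rfl | hp
  · exact hq'
  · exact h p hp

/-- The state when columns with index less than `t` have been processed. -/
structure Inv (D M : Matrix (Fin N) (Fin N) (ZMod 2)) (t : ℕ) (s : State N) : Prop where
  recorded : ∀ l m, s.P l = some m ↔ (m : ℕ) < t ∧ IsLow (M.transpose m) l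
  isLow : ∀ l m, s.P l = some m → IsLow (s.R.transpose m) l
  support : ∀ j : Fin N, (j : ℕ) < t → ∀ e, s.R e j ≠ 0 →
    M.transpose e = 0 ∧ e < j ∧ ∀ k, IsLow (M.transpose k) e → j ≤ k
  mem : ∀ j : Fin N, (j : ℕ) < t → s.R.transpose j ∈ (spanLT D t).map (killNegative M)
  bitflips_le : s.bitflips ≤ s.settledCost D M

/-- The state while column `j` is processed. -/
structure Current (D M : Matrix (Fin N) (Fin N) (ZMod 2)) (j : Fin N) (s : State N) : Prop where
  inv : Inv D M j s
  -- The second alternative covers rows already paired with an earlier column: they are entries of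
  -- `D` not yet eliminated, never produced by additions.
  support : ∀ e, s.R e j ≠ 0 →
    M.transpose e = 0 ∧ e < j ∧ ((∀ k, IsLow (M.transpose k) e → j ≤ k) ∨ D e j ≠ 0)
  sub_mem : s.R.transpose j - killNegative M (D.transpose j) ∈
    (spanLT D j).map (killNegative M)
  rest : ∀ k, j < k → s.R.transpose k = D.transpose k

/-- The state of the main loop before column `t` is processed. -/
structure Ready (D M : Matrix (Fin N) (Fin N) (ZMod 2)) (t : ℕ) (s : State N) : Prop where
  inv : Inv D M t s
  rest : ∀ k : Fin N, t ≤ k → s.R.transpose k = D.transpose k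

/-! ### Single operations of the algorithm preserve the invariants. -/

section Steps

variable {D M : Matrix (Fin N) (Fin N) (ZMod 2)} {t : ℕ} {s : State N}

theorem Inv.pivot_unique (hI : Inv D M t s) {l l' m : Fin N} (h : s.P l = some m)
    (h' : s.P l' = some m) : l = l' :=
  (hI.isLow _ _ h).eq (hI.isLow _ _ h')

theorem State.add_apply_self (s : State N) (e m j : Fin N) :
    (s.add m j).R e j = s.R e j + s.R e m := by
  simp [State.add, addColumn]

theorem State.add_apply_of_ne (s : State N) (e m : Fin N) {j k : Fin N} (h : k ≠ j) :
    (s.add m j).R e k = s.R e k := by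
  simp [State.add, addColumn, h]

theorem State.transpose_add_of_ne (s : State N) (m : Fin N) {j k : Fin N} (h : k ≠ j) :
    (s.add m j).R.transpose k = s.R.transpose k :=
  transpose_addColumn_of_ne _ h

/-- A row in which the recorded column `m`, after the call for `m`, has an entry is either its pivot
row or not paired. -/
theorem Inv.eq_or_not_recorded (hI : Inv D M t s) {l m e : Fin N} (hm : s.P l = some m)
    (hno : ∀ i m', ¬ s.PairedWith m i m') (he : s.R e m ≠ 0) :
    e = l ∨ ∀ m', s.P e ≠ some m' := by
  by_cases h : ∃ m', s.P e = some m'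
  · obtain ⟨m', hm'⟩ := h
    by_cases hmm : m' = m
    · subst hmm
      exact Or.inl (hI.pivot_unique hm' hm)
    · exact absurd ⟨he, hm', hmm⟩ (hno e m')
  · exact Or.inr fun m' hm' => h ⟨m', hm'⟩

theorem Inv.le_of_not_recorded (hI : Inv D M t s) {e k : Fin N} (he : ∀ m', s.P e ≠ some m')
    (hk : IsLow (M.transpose k) e) : t ≤ k :=
  not_lt.1 fun h => he k ((hI.recorded e k).2 ⟨h, hk⟩)

/-- The only recorded row that the addition changes is `l`, where column `j` was nonzero. Hence no
pair is ever paid for twice. -/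
theorem Inv.settled_add (hI : Inv D M t s) {l m j : Fin N} (hm : s.P l = some m)
    (hno : ∀ i m', ¬ s.PairedWith m i m') (hlj : s.R l j ≠ 0) (p : Fin N × Fin N)
    (hp : s.Settled p) : (s.add m j).Settled p := by
  obtain ⟨l', hl', h0⟩ := hp
  refine ⟨l', hl', ?_⟩
  by_cases hpj : p.2 = j
  · rw [hpj] at h0 ⊢
    rw [State.add_apply_self, h0, zero_add]
    by_contra hne
    rcases hI.eq_or_not_recorded hm hno hne with rfl | h
    · exact hlj h0
    · exact h _ hl'
  · rw [State.add_apply_of_ne _ _ _ hpj, h0]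

/-- Apart from the pivot `l`, the entries of column `m` lie in unrecorded rows, whose partners are
at least `t`, hence at least `j`. The row `l` either satisfies the same bound or is charged to the
entry `D l j`. -/
theorem Inv.colSize_le (hI : Inv D M t s) {l m j : Fin N} (hm : s.P l = some m)
    (hno : ∀ i m', ¬ s.PairedWith m i m') (hjt : (j : ℕ) ≤ t)
    (hl : l < j ∧ ((∀ k, IsLow (M.transpose k) l → j ≤ k) ∨ D l j ≠ 0)) :
    colSize s.R m ≤ additionCost D M (m, j) := by
  classical
  obtain ⟨hmt, hlow⟩ := (hI.recorded l m).1 hm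
  have hmain : ∀ e, s.R e m ≠ 0 → (e = l → ∀ k, IsLow (M.transpose k) l → j ≤ k) →
      M.transpose e = 0 ∧ e < m ∧ e < j ∧ ∀ k, IsLow (M.transpose k) e → m ≤ k ∧ j ≤ k := by
    intro e he hel
    obtain ⟨h0, hem, hmk⟩ := hI.support m hmt e he
    refine ⟨h0, hem, lt_of_le_of_lt ((hI.isLow l m hm).le he) hl.1, fun k hk => ⟨hmk k hk, ?_⟩⟩
    rcases hI.eq_or_not_recorded hm hno he with rfl | h
    · exact hel rfl k hk
    · exact hjt.trans (hI.le_of_not_recorded h hk)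
  unfold colSize additionCost
  by_cases hD : D l j ≠ 0
  · rw [if_pos ⟨l, hlow, hD⟩]
    refine le_trans (Finset.card_le_card fun e he => ?_) (Finset.card_insert_le l _)
    simp only [Finset.mem_insert, Finset.mem_filter, Finset.mem_univ, true_and] at he ⊢
    by_cases hel : e = l
    · exact Or.inl hel
    · exact Or.inr (hmain e he fun h => absurd h hel)
  · refine le_trans (Finset.card_le_card fun e he => ?_) (Nat.le_add_right _ _)
    simp only [Finset.mem_filter, Finset.mem_univ, true_and] at he ⊢
    exact hmain e he fun _ => hl.2.resolve_right hD

theorem Inv.bitflips_add_le (hI : Inv D M t s) {l m j : Fin N} (hm : s.P l = some m)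
    (hno : ∀ i m', ¬ s.PairedWith m i m') (hjt : (j : ℕ) ≤ t) (hlj : s.R l j ≠ 0)
    (hl : l < j ∧ ((∀ k, IsLow (M.transpose k) l → j ≤ k) ∨ D l j ≠ 0)) :
    (s.add m j).bitflips ≤ (s.add m j).settledCost D M := by
  refine (add_le_add hI.bitflips_le (hI.colSize_le hm hno hjt hl)).trans ?_
  refine State.settledCost_add_le D M (hI.settled_add hm hno hlj) ?_ ⟨l, hm, ?_⟩
  · rintro ⟨l', hl', h0⟩
    rw [hI.pivot_unique hl' hm] at h0
    exact hlj h0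
  · rw [State.add_apply_self]
    exact ZMod.two_add_eq_zero_of_ne_zero hlj (hI.isLow l m hm).1

/-- Column `m` may lie to the right of `j`; column `j` keeps its pivot because `l < l₀`. -/
theorem Inv.add (hI : Inv D M t s) {l l₀ m j : Fin N} (hm : s.P l = some m)
    (hno : ∀ i m', ¬ s.PairedWith m i m') (hj : s.P l₀ = some j) (hlj : s.R l j ≠ 0)
    (hmj : m ≠ j) : Inv D M t (s.add m j) := by
  have hjt := ((hI.recorded _ _).1 hj).1
  have hmt := ((hI.recorded _ _).1 hm).1
  have hll : l < l₀ := by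
    refine lt_of_le_of_ne ((hI.isLow _ _ hj).le hlj) ?_
    rintro rfl
    exact hmj (Option.some.inj (hm.symm.trans hj))
  have hlsupp := hI.support j hjt l hlj
  refine ⟨hI.recorded, fun l' k hk => ?_, fun k hk e he => ?_, fun k hk => ?_,
    hI.bitflips_add_le hm hno hjt.le hlj ⟨hlsupp.2.1, Or.inl hlsupp.2.2⟩⟩
  · by_cases hkj : k = j
    · subst hkj
      rw [hI.pivot_unique hk hj]
      have := (hI.isLow _ _ hm).add_of_lt (hI.isLow _ _ hj) hll
      rw [add_comm] at this
      simpa only [State.add, transpose_addColumn_self] using this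
    · rw [State.transpose_add_of_ne _ _ hkj]
      exact hI.isLow l' k hk
  · by_cases hkj : k = j
    · subst hkj
      by_cases hem : s.R e m = 0
      · refine hI.support k hk e ?_
        rwa [State.add_apply_self, hem, add_zero] at he
      · refine ⟨(hI.support m hmt e hem).1,
          lt_of_le_of_lt ((hI.isLow _ _ hm).le hem) hlsupp.2.1, fun k' hk' => ?_⟩
        rcases hI.eq_or_not_recorded hm hno hem with rfl | h
        · exact hlsupp.2.2 k' hk'
        · exact hjt.le.trans (hI.le_of_not_recorded h hk')
    · exact hI.support k hk e (by rwa [State.add_apply_of_ne _ _ _ hkj] at he)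
  · by_cases hkj : k = j
    · subst hkj
      simp only [State.add, transpose_addColumn_self]
      exact add_mem (hI.mem _ hk) (hI.mem _ hmt)
    · rw [State.transpose_add_of_ne _ _ hkj]
      exact hI.mem k hk

theorem Current.add {j : Fin N} (hC : Current D M j s) {l m : Fin N} (hm : s.P l = some m)
    (hno : ∀ i m', ¬ s.PairedWith m i m') (hlj : s.R l j ≠ 0) : Current D M j (s.add m j) := by
  have hI := hC.inv
  have hmj : m < j := ((hI.recorded _ _).1 hm).1
  have hlsupp := hC.support l hlj
  have hne : ∀ {k : Fin N}, (k : ℕ) < j → k ≠ j := fun h => (Fin.lt_def.2 h).ne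
  refine ⟨⟨hI.recorded, fun l' k hk => ?_, fun k hk e he => ?_, fun k hk => ?_,
    hI.bitflips_add_le hm hno le_rfl hlj hlsupp.2⟩, fun e he => ?_, ?_, fun k hk => ?_⟩
  · rw [State.transpose_add_of_ne _ _ (hne ((hI.recorded _ _).1 hk).1)]
    exact hI.isLow l' k hk
  · exact hI.support k hk e (by rwa [State.add_apply_of_ne _ _ _ (hne hk)] at he)
  · rw [State.transpose_add_of_ne _ _ (hne hk)]
    exact hI.mem k hk
  · by_cases hem : s.R e m = 0
    · refine hC.support e ?_
      rwa [State.add_apply_self, hem, add_zero] at he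
    · refine ⟨(hI.support m hmj e hem).1, ((hI.support m hmj e hem).2.1).trans hmj, ?_⟩
      rcases hI.eq_or_not_recorded hm hno hem with rfl | h
      · exact hlsupp.2.2
      · exact Or.inl fun k hk => hI.le_of_not_recorded h hk
  · simp only [State.add, transpose_addColumn_self]
    rw [add_sub_right_comm]
    exact add_mem hC.sub_mem (hI.mem _ hmj)
  · rw [State.transpose_add_of_ne _ _ hk.ne']
    exact hC.rest k hk

/-- The recording at the end of a recursive call is harmless. -/
theorem Inv.record_eq (hI : Inv D M t s) {l₀ j : Fin N} (hj : s.P l₀ = some j) :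
    s.record j = s := by
  have hlow := (low_eq_coe_iff _ _ _).2 (hI.isLow _ _ hj)
  have : (fun i : Fin N => if low s.R j = (i : WithBot (Fin N)) then some j else s.P i) = s.P := by
    funext i
    rw [hlow]
    split_ifs with h
    · rw [← WithBot.coe_injective h, hj]
    · rfl
  cases s
  simp only [State.record] at this ⊢
  rw [this]

/-- The effect of a call for a column that has been recorded with pivot `l₀`. -/
theorem Reduce.recorded {s' : State N} {j : Fin N} (h : Reduce j s s') (hI : Inv D M t s)
    {l₀ : Fin N} (hj : s.P l₀ = some j) :
    Inv D M t s' ∧ s'.P = s.P ∧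
      (∀ k : Fin N, t ≤ k → s'.R.transpose k = s.R.transpose k) ∧
      (∀ l' k, s.P l' = some k → l₀ < l' → s'.R.transpose k = s.R.transpose k) ∧
      ∀ i m, ¬ s'.PairedWith j i m := by
  induction h generalizing l₀ with
  | done j s h =>
    rw [hI.record_eq hj]
    exact ⟨hI, rfl, fun _ _ => rfl, fun _ _ _ _ => rfl, h⟩
  | step j l m s s₁ s' hl hmax hcall hloop ih₁ ih₂ =>
    obtain ⟨hlj, hm, hmj⟩ := hl
    have hll : l < l₀ := by
      refine lt_of_le_of_ne ((hI.isLow _ _ hj).le hlj) ?_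
      rintro rfl
      exact hmj (Option.some.inj (hm.symm.trans hj))
    obtain ⟨hI₁, hP₁, hge₁, hgt₁, hno₁⟩ := ih₁ hI hm
    have hjt := ((hI.recorded _ _).1 hj).1
    -- The call for `m` leaves columns with recorded pivot above `l` unchanged, in particular column
    -- `j`.
    have hlj₁ : s₁.R l j ≠ 0 := by
      have := congrFun (hgt₁ l₀ j hj hll) l
      simp only [Matrix.transpose_apply] at this
      rwa [this]
    have hm₁ : s₁.P l = some m := by rw [hP₁, hm]
    have hj₁ : s₁.P l₀ = some j := by rw [hP₁, hj]
    obtain ⟨hI₂, hP₂, hge₂, hgt₂, hno₂⟩ := ih₂ (hI₁.add hm₁ hno₁ hj₁ hlj₁ hmj) hj₁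
    refine ⟨hI₂, hP₂.trans hP₁, fun k hk => ?_, fun l' k hk hlt => ?_, hno₂⟩
    · have hkj : k ≠ j := by
        rintro rfl
        omega
      rw [hge₂ k hk, State.transpose_add_of_ne _ _ hkj, hge₁ k hk]
    · have hkj : k ≠ j := by
        rintro rfl
        exact hlt.ne (hI.pivot_unique hj hk)
      rw [hgt₂ l' k (by simpa only [State.add, hP₁] using hk) hlt,
        State.transpose_add_of_ne _ _ hkj, hgt₁ l' k hk (hll.trans hlt)]

/-- One pass through the while loop keeps the properties of a column in progress. -/
theorem Current.step {j : Fin N} (hC : Current D M j s) {l m : Fin N} {s₁ : State N}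
    (hl : s.PairedWith j l m) (h : Reduce m s s₁) : Current D M j (s₁.add m j) := by
  obtain ⟨hlj, hm, -⟩ := hl
  obtain ⟨hI₁, hP₁, hge₁, -, hno₁⟩ := h.recorded hC.inv hm
  have hcol : ∀ e, s₁.R e j = s.R e j := congrFun (hge₁ j le_rfl)
  have hC₁ : Current D M j s₁ := by
    refine ⟨hI₁, fun e he => hC.support e (by rwa [← hcol]), ?_, fun k hk => ?_⟩
    · rw [hge₁ j le_rfl]
      exact hC.sub_mem
    · rw [hge₁ k (Fin.lt_def.1 hk).le, hC.rest k hk]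
  exact hC₁.add (by rw [hP₁, hm]) hno₁ (by rwa [hcol])

theorem Current.record (hD : D * D = 0) (hM : IsReductionOf D M) {j : Fin N}
    (hC : Current D M j s) (hno : ∀ i m, ¬ s.PairedWith j i m) :
    Ready D M (j + 1) (s.record j) := by
  have hI := hC.inv
  have hun : ∀ e, s.R e j ≠ 0 → ∀ m : Fin N, m < j → ¬ IsLow (M.transpose m) e :=
    fun e he m hm hlow => hno e m ⟨he, (hI.recorded e m).2 ⟨hm, hlow⟩, hm.ne⟩
  have hlow : ∀ i : Fin N, low s.R j = (i : WithBot (Fin N)) ↔ IsLow (M.transpose j) i := fun i =>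
    (low_eq_coe_iff _ _ _).trans (hM.isLow_iff hD hC.sub_mem hun i)
  have hrec : ∀ l m, (s.record j).P l = some m ↔
      (m : ℕ) < j + 1 ∧ IsLow (M.transpose m) l := by
    intro l m
    simp only [State.record]
    split_ifs with h
    · rw [hlow] at h
      constructor
      · intro hm
        rw [← Option.some.inj hm]
        exact ⟨Nat.lt_succ_self _, h⟩
      · rintro ⟨-, hm⟩
        rw [hM.2.eq_of_isLow h hm]
    · rw [hlow] at h
      rw [hI.recorded]
      refine and_congr_left fun hm => ?_
      have : (m : ℕ) ≠ j := fun hmj => h (Fin.ext hmj ▸ hm)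
      omega
  have hold : ∀ l m, s.P l = some m → (s.record j).P l = some m := fun l m hm => by
    rw [hrec]
    obtain ⟨h, h'⟩ := (hI.recorded _ _).1 hm
    exact ⟨by omega, h'⟩
  have hsplit : ∀ {k : Fin N}, (k : ℕ) < j + 1 → (k : ℕ) < j ∨ k = j := fun h => by
    rw [Fin.ext_iff]
    omega
  refine ⟨⟨hrec, fun l m hm => ?_, fun k hk e he => ?_, fun k hk => ?_, ?_⟩, fun k hk => ?_⟩
  · obtain ⟨hmj, hml⟩ := (hrec l m).1 hm
    rcases hsplit hmj with h | rfl
    · exact hI.isLow l m ((hI.recorded l m).2 ⟨h, hml⟩)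
    · exact (low_eq_coe_iff _ _ _).1 ((hlow l).2 hml)
  · rcases hsplit hk with h | rfl
    · exact hI.support k h e he
    · obtain ⟨h0, hlt, -⟩ := hC.support e he
      -- With no paired entry left, the exceptional alternative in `Current.support` is no longer
      -- needed.
      exact ⟨h0, hlt, fun k' hk' => not_lt.1 fun h => hun e he k' h hk'⟩
  · have hmono : (spanLT D j).map (killNegative M) ≤ (spanLT D (j + 1)).map (killNegative M) :=
      Submodule.map_mono (spanLT_mono D (Nat.le_succ _))
    rcases hsplit hk with h | rfl
    · exact hmono (hI.mem k h)
    · have := add_mem (hmono hC.sub_mem)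
        (Submodule.mem_map_of_mem (f := killNegative M) (transpose_mem_spanLT D hk))
      rwa [sub_add_cancel] at this
  · refine hI.bitflips_le.trans (State.settledCost_mono D M ?_)
    rintro p ⟨l, hl, h0⟩
    exact ⟨l, hold _ _ hl, h0⟩
  · exact hC.rest k (Fin.lt_def.2 hk)

theorem Reduce.current (hD : D * D = 0) (hM : IsReductionOf D M) {s' : State N} {j : Fin N}
    (h : Reduce j s s') (hC : Current D M j s) : Ready D M (j + 1) s' := by
  induction h with
  | done j s h => exact hC.record hD hM h
  | step j l m s s₁ s' hl hmax hcall hloop _ ih => exact ih (hC.step hl hcall)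

theorem Ready.removeNegative (hup : ∀ i j, D i j ≠ 0 → i < j) {j : Fin N}
    (h : Ready D M j s) : Current D M j (s.removeNegative j) := by
  classical
  have hI := h.inv
  have hcol : (s.removeNegative j).R.transpose j = killNegative M (D.transpose j) := by
    funext e
    have hej : s.R e j = D e j := congrFun (h.rest j le_rfl) e
    simp only [State.removeNegative, Matrix.transpose_apply, Matrix.updateCol_self, hej]
    by_cases h0 : M.transpose e = 0
    · rw [killNegative_apply_of_eq_zero h0, if_neg]
      · rfl
      · rintro ⟨l, hl⟩
        exact ((hI.recorded _ _).1 hl).2.ne_zero h0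
    · rw [killNegative_apply_of_ne_zero h0]
      by_cases hDe : D e j = 0
      · rw [hDe, ite_self]
      · obtain ⟨l, hl⟩ := exists_isLow h0
        -- Entries of column `j` of `D` lie in rows `e < j`, so negativity of `e` has already been
        -- recorded.
        exact if_pos ⟨l, (hI.recorded _ _).2 ⟨hup _ _ hDe, hl⟩⟩
  have hne : ∀ k, k ≠ j → (s.removeNegative j).R.transpose k = s.R.transpose k := by
    intro k hk
    ext e
    simp [State.removeNegative, hk]
  have hlt : ∀ {k : Fin N}, (k : ℕ) < j → k ≠ j := fun h => (Fin.lt_def.2 h).ne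
  refine ⟨⟨hI.recorded, fun l m hm => ?_, fun k hk e he => ?_, fun k hk => ?_, ?_⟩,
    fun e he => ?_, ?_, fun k hk => ?_⟩
  · rw [hne m (hlt ((hI.recorded _ _).1 hm).1)]
    exact hI.isLow l m hm
  · exact hI.support k hk e ((congrFun (hne k (hlt hk)) e).symm.trans_ne he)
  · rw [hne k (hlt hk)]
    exact hI.mem k hk
  · refine hI.bitflips_le.trans (State.settledCost_mono D M ?_)
    rintro p ⟨l, hl, h0⟩
    refine ⟨l, hl, ?_⟩
    by_cases hp : p.2 = j
    · rw [hp] at h0 ⊢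
      simp [State.removeNegative, h0]
    · exact (congrFun (hne _ hp) l).trans h0
  · have hval : killNegative M (D.transpose j) e ≠ 0 := by
      rw [← hcol]
      exact he
    by_cases h0 : M.transpose e = 0
    · rw [killNegative_apply_of_eq_zero h0] at hval
      exact ⟨h0, hup _ _ hval, Or.inr hval⟩
    · exact absurd (killNegative_apply_of_ne_zero h0 _) hval
  · rw [hcol, sub_self]
    exact zero_mem _
  · rw [hne k hk.ne', h.rest k (Fin.lt_def.1 hk).le]

end Steps

/-! ### The main loop and the amortized bound. -/

section Loop

variable {D M : Matrix (Fin N) (Fin N) (ZMod 2)}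

theorem Loop.ready (hD : D * D = 0) (hM : IsReductionOf D M) (hup : ∀ i j, D i j ≠ 0 → i < j)
    {js : List (Fin N)} {s s' : State N} (h : Loop js s s') {t : ℕ} (ht : t ≤ N)
    (hjs : js = (List.finRange N).drop t) (hs : Ready D M t s) : Ready D M N s' := by
  induction h generalizing t with
  | nil s =>
    have : N ≤ t := by simpa using List.drop_eq_nil_iff.1 hjs.symm
    exact le_antisymm ht this ▸ hs
  | cons j js s s₁ s' hred _ ih =>
    have htN : t < N := by
      by_contra hle
      rw [List.drop_eq_nil_of_le (by simpa using hle)] at hjs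
      simp at hjs
    rw [List.drop_eq_getElem_cons (by simpa using htN), List.cons.injEq] at hjs
    have hjt : (j : ℕ) = t := by simp [hjs.1]
    subst hjt
    exact ih htN hjs.2 (hred.current hD hM (hs.removeNegative hup))

theorem ready_initial (D M : Matrix (Fin N) (Fin N) (ZMod 2)) :
    Ready D M 0 ⟨D, fun _ => none, 0⟩ :=
  ⟨⟨by simp, by simp, by simp, by simp, by simp⟩, fun _ _ => rfl⟩

theorem Main.bitflips_le (hD : D * D = 0) (hM : IsReductionOf D M)
    (hup : ∀ i j, D i j ≠ 0 → i < j) {s : State N} (h : Main D s) :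
    s.bitflips ≤ ∑ p, additionCost D M p := by
  classical
  exact (Loop.ready hD hM hup h (Nat.zero_le _) (List.drop_zero).symm
    (ready_initial D M)).inv.bitflips_le.trans
      (Finset.sum_le_sum_of_subset (Finset.filter_subset _ _))

/-! ### Termination. -/

open Classical in
/-- The number of paired entries of column `j`. -/
noncomputable def State.pairedCount (s : State N) (j : Fin N) : ℕ :=
  (Finset.univ.filter fun i => ∃ m, s.PairedWith j i m).card

/-- A call terminates if its recursive calls do and each pass through the while loop lowers the
number of paired entries. -/
theorem exists_reduce_of_step (j : Fin N) (Q : State N → Prop)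
    (hQ : ∀ s l m, Q s → s.PairedWith j l m → ∃ s₁, Reduce m s s₁ ∧ Q (s₁.add m j) ∧
      (s₁.add m j).pairedCount j < s.pairedCount j) (s : State N) (hs : Q s) :
    ∃ s', Reduce j s s' := by
  classical
  induction hn : s.pairedCount j using Nat.strong_induction_on generalizing s with
  | _ n ih =>
    subst hn
    by_cases h : ∀ i m, ¬ s.PairedWith j i m
    · exact ⟨_, Reduce.done j s h⟩
    push Not at h
    obtain ⟨i, m, hi⟩ := h
    have hne : (Finset.univ.filter fun i => ∃ m, s.PairedWith j i m).Nonempty :=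
      ⟨i, by simpa using ⟨m, hi⟩⟩
    obtain ⟨m', hm'⟩ := (Finset.mem_filter.1 (Finset.max'_mem _ hne)).2
    obtain ⟨s₁, hs₁, hQ₁, hlt⟩ := hQ s _ m' hs hm'
    obtain ⟨s', hs'⟩ := ih _ hlt _ hQ₁ rfl
    exact ⟨s', Reduce.step j _ m' s s₁ s' hm'
      (fun k m'' hk => Finset.le_max' _ k (by simpa using ⟨m'', hk⟩)) hs₁ hs'⟩

/-- The added column meets recorded rows only in `l`, where the two entries cancel. -/
theorem Inv.pairedCount_add_lt {t : ℕ} {s s₁ : State N} (hI : Inv D M t s₁) {j l m : Fin N}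
    (hl : s.PairedWith j l m) (hP : s₁.P = s.P) (hcol : ∀ e, s₁.R e j = s.R e j)
    (hno : ∀ i m', ¬ s₁.PairedWith m i m') :
    (s₁.add m j).pairedCount j < s.pairedCount j := by
  classical
  obtain ⟨hlj, hm, hmj⟩ := hl
  rw [← hP] at hm
  refine Finset.card_lt_card ((Finset.ssubset_iff_of_subset fun i hi => ?_).2 ⟨l, ?_, ?_⟩)
  · simp only [Finset.mem_filter, Finset.mem_univ, true_and] at hi ⊢
    obtain ⟨m', hne, hPi, hmj'⟩ := hi
    have hPi' : s₁.P i = some m' := hPi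
    refine ⟨m', ?_, hP ▸ hPi', hmj'⟩
    rw [State.add_apply_self, hcol] at hne
    by_cases h0 : s₁.R i m = 0
    · rwa [h0, add_zero] at hne
    · rcases hI.eq_or_not_recorded hm hno h0 with rfl | h
      · exact hlj
      · exact absurd hPi' (h m')
  · simpa using ⟨m, hlj, hP ▸ hm, hmj⟩
  · simp only [Finset.mem_filter, Finset.mem_univ, true_and]
    rintro ⟨m', hne, -⟩
    rw [State.add_apply_self, hcol] at hne
    exact hne (ZMod.two_add_eq_zero_of_ne_zero hlj (hI.isLow l m hm).1)

/-- Well-founded induction on the pivot: a recursive call concerns a smaller pivot row. -/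
theorem Inv.exists_reduce {t : ℕ} {s : State N} (hI : Inv D M t s) {l₀ j : Fin N}
    (hj : s.P l₀ = some j) : ∃ s', Reduce j s s' := by
  induction l₀ using WellFoundedLT.induction generalizing s j with
  | _ l₀ ih =>
    refine exists_reduce_of_step j (fun s => Inv D M t s ∧ s.P l₀ = some j) ?_ s ⟨hI, hj⟩
    rintro s l m ⟨hI, hj⟩ hl
    obtain ⟨hlj, hm, hmj⟩ := id hl
    have hll : l < l₀ := by
      refine lt_of_le_of_ne ((hI.isLow _ _ hj).le hlj) ?_
      rintro rfl
      exact hmj (Option.some.inj (hm.symm.trans hj))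
    obtain ⟨s₁, hs₁⟩ := ih l hll hI hm
    obtain ⟨hI₁, hP₁, -, hgt₁, hno₁⟩ := hs₁.recorded hI hm
    have hcol : ∀ e, s₁.R e j = s.R e j := congrFun (hgt₁ l₀ j hj hll)
    have hj₁ : s₁.P l₀ = some j := by rw [hP₁, hj]
    exact ⟨s₁, hs₁, ⟨hI₁.add (by rw [hP₁, hm]) hno₁ hj₁ (by rwa [hcol]) hmj, hj₁⟩,
      hI₁.pairedCount_add_lt hl hP₁ hcol hno₁⟩

theorem Current.exists_reduce {s : State N} {j : Fin N} (hC : Current D M j s) :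
    ∃ s', Reduce j s s' := by
  refine exists_reduce_of_step j (Current D M j) (fun s l m hC hl => ?_) s hC
  obtain ⟨s₁, hs₁⟩ := hC.inv.exists_reduce hl.2.1
  obtain ⟨hI₁, hP₁, hge₁, -, hno₁⟩ := hs₁.recorded hC.inv hl.2.1
  exact ⟨s₁, hs₁, hC.step hl hs₁,
    hI₁.pairedCount_add_lt hl hP₁ (congrFun (hge₁ j le_rfl)) hno₁⟩

theorem exists_loop (hD : D * D = 0) (hM : IsReductionOf D M) (hup : ∀ i j, D i j ≠ 0 → i < j)
    (n t : ℕ) (ht : t + n = N) (s : State N) (hs : Ready D M t s) :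
    ∃ s', Loop ((List.finRange N).drop t) s s' := by
  induction n generalizing t s with
  | zero =>
    rw [List.drop_eq_nil_of_le (by simpa using ht.ge)]
    exact ⟨s, Loop.nil s⟩
  | succ n ih =>
    have htN : t < N := by omega
    rw [List.drop_eq_getElem_cons (by simpa using htN)]
    have hC := Ready.removeNegative (j := ⟨t, htN⟩) hup hs
    obtain ⟨s₁, hs₁⟩ := hC.exists_reduce
    obtain ⟨s', hs'⟩ := ih (t + 1) (by omega) s₁ (hs₁.current hD hM hC)
    exact ⟨s', Loop.cons _ _ _ s₁ _ (by simpa using hs₁) hs'⟩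

theorem exists_main (hD : D * D = 0) (hM : IsReductionOf D M)
    (hup : ∀ i j, D i j ≠ 0 → i < j) : ∃ s, Main D s :=
  exists_loop hD hM hup N 0 (Nat.zero_add N) _ (ready_initial D M)

end Loop

end Retrospective


/-! ## The sum of the costs -/

namespace Retrospective

variable {N : ℕ}

open Classical in
/-- The index at which row `e` is paired, `N` if there is none. -/
noncomputable def partner (M : Matrix (Fin N) (Fin N) (ZMod 2)) (e : Fin N) : Fin (N + 1) :=
  if h : ∃ k, IsLow (M.transpose k) e then h.choose.castSucc else Fin.last N

theorem mk_partner_mem_extendedPairs {M : Matrix (Fin N) (Fin N) (ZMod 2)} {e : Fin N}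
    (he : M.transpose e = 0) : (e, partner M e) ∈ extendedPairs M := by
  simp only [extendedPairs, Finset.mem_filter, Finset.mem_univ, true_and]
  by_cases h : ∃ k, IsLow (M.transpose k) e
  · exact Or.inl ⟨h.choose, by simp [partner, h], (low_eq_coe_iff _ _ _).2 h.choose_spec⟩
  · refine Or.inr ⟨by simp [partner, h], fun j => ⟨fun hj => ?_, fun hj => ?_⟩⟩
    · exact h ⟨j, (low_eq_coe_iff _ _ _).1 hj⟩
    · exact ((low_eq_coe_iff _ _ _).1 hj).ne_zero he

theorem le_partner {M : Matrix (Fin N) (Fin N) (ZMod 2)} {e m : Fin N}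
    (h : ∀ k, IsLow (M.transpose k) e → m ≤ k) : (m : ℕ) ≤ partner M e := by
  unfold partner
  split_ifs with hk
  · exact Fin.le_def.1 (h _ hk.choose_spec)
  · exact m.2.le

open Classical in
-- The pairs lie in the square of the half-open interval from `e` (excluded) to its partner.
theorem card_pairs_le (M : Matrix (Fin N) (Fin N) (ZMod 2)) (e : Fin N) :
    (Finset.univ.filter fun p : Fin N × Fin N => e < p.1 ∧ e < p.2 ∧
      ∀ k, IsLow (M.transpose k) e → p.1 ≤ k ∧ p.2 ≤ k).card ≤ ((partner M e : ℕ) - e) ^ 2 := by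
  have hcard : ((partner M e : ℕ) - e) ^ 2 =
      (Finset.Ioc (e : ℕ) (partner M e) ×ˢ Finset.Ioc (e : ℕ) (partner M e)).card := by
    rw [Finset.card_product, Nat.card_Ioc, sq]
  rw [hcard]
  refine Finset.card_le_card_of_injOn (fun p => ((p.1 : ℕ), (p.2 : ℕ))) (fun p hp => ?_) ?_
  · have hp := (Finset.mem_filter.1 (Finset.mem_coe.1 hp)).2
    simp only [Finset.coe_product, Set.mem_prod, Finset.coe_Ioc, Set.mem_Ioc]
    exact ⟨⟨hp.1, le_partner fun k hk => (hp.2.2 k hk).1⟩,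
      ⟨hp.2.1, le_partner fun k hk => (hp.2.2 k hk).2⟩⟩
  · rintro ⟨a, b⟩ - ⟨c, d⟩ - h
    simp only [Prod.mk.injEq, Fin.val_inj] at h
    rw [h.1, h.2]

theorem sum_additionCost_le (D : Matrix (Fin N) (Fin N) (ZMod 2))
    {M : Matrix (Fin N) (Fin N) (ZMod 2)} (hM : IsReducedMatrix M) :
    ((∑ p, additionCost D M p : ℕ) : ℤ) ≤
      ∑ p ∈ extendedPairs M, (((p.2 : ℕ) : ℤ) - ((p.1 : ℕ) : ℤ)) ^ 2 +
        ∑ j, (colSize D j : ℤ) := by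
  classical
  unfold additionCost
  rw [Finset.sum_add_distrib, Nat.cast_add]
  refine add_le_add ?_ ?_
  · have hswap : (∑ p : Fin N × Fin N, (Finset.univ.filter fun e => M.transpose e = 0 ∧
        e < p.1 ∧ e < p.2 ∧ ∀ k, IsLow (M.transpose k) e → p.1 ≤ k ∧ p.2 ≤ k).card) =
        ∑ e ∈ Finset.univ.filter (fun e => M.transpose e = 0),
          (Finset.univ.filter fun p : Fin N × Fin N => e < p.1 ∧ e < p.2 ∧
            ∀ k, IsLow (M.transpose k) e → p.1 ≤ k ∧ p.2 ≤ k).card := by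
      simp only [Finset.card_filter]
      rw [Finset.sum_comm, Finset.sum_filter]
      refine Finset.sum_congr rfl fun e _ => ?_
      by_cases h : M.transpose e = 0 <;> simp [h]
    rw [hswap, Nat.cast_sum]
    have himage : ∑ e ∈ Finset.univ.filter (fun e => M.transpose e = 0),
        (((partner M e : ℕ) : ℤ) - ((e : ℕ) : ℤ)) ^ 2 ≤
        ∑ p ∈ extendedPairs M, (((p.2 : ℕ) : ℤ) - ((p.1 : ℕ) : ℤ)) ^ 2 := by
      rw [← Finset.sum_image (f := fun p : Fin N × Fin (N + 1) =>
        (((p.2 : ℕ) : ℤ) - ((p.1 : ℕ) : ℤ)) ^ 2) (g := fun e => (e, partner M e))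
        (fun a _ b _ h => (Prod.mk.inj h).1)]
      refine Finset.sum_le_sum_of_subset_of_nonneg (fun p hp => ?_) fun _ _ _ => sq_nonneg _
      obtain ⟨e, he, rfl⟩ := Finset.mem_image.1 hp
      exact mk_partner_mem_extendedPairs (Finset.mem_filter.1 he).2
    refine le_trans (Finset.sum_le_sum fun e _ => ?_) himage
    refine (Nat.cast_le.2 (card_pairs_le M e)).trans ?_
    rw [Nat.cast_pow]
    rcases le_total (e : ℕ) (partner M e : ℕ) with h | h
    · rw [Nat.cast_sub h]
    · rw [Nat.sub_eq_zero_of_le h]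
      exact (by simpa using sq_nonneg _)
  · rw [← Nat.cast_sum, Nat.cast_le, ← Finset.univ_product_univ, Finset.sum_product_right]
    refine Finset.sum_le_sum fun j _ => ?_
    rw [← Finset.card_filter]
    -- For fixed `j`, sending `m` to its pivot is injective into the nonzero rows of column `j`, as
    -- `M` is reduced.
    refine Finset.card_le_card_of_forall_subsingleton (fun m l => IsLow (M.transpose m) l)
      (fun m hm => ?_) fun l _ a ha b hb => hM.eq_of_isLow ha.2 hb.2
    obtain ⟨l, hl, hD⟩ := (Finset.mem_filter.1 hm).2
    exact ⟨l, by simpa using hD, hl⟩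

end Retrospective

/-! ## The boundary matrix of a filtration -/

namespace SimplexwiseFiltration

variable {V : Type*} {N : ℕ} (F : SimplexwiseFiltration V N)

theorem faces_mono {a b : Fin (N + 1)} (h : a ≤ b) : (F.complex a).faces ⊆ (F.complex b).faces :=
  (Fin.monotone_iff_le_succ (f := fun i => (F.complex i).faces)).2 F.mono h

theorem simplex_mem (i : Fin N) : F.simplex i ∈ (F.complex i.succ).faces := by
  have : F.simplex i ∈ (F.complex i.succ).faces \ (F.complex i.castSucc).faces := by
    rw [F.faces_diff]
    rfl
  exact this.1

theorem simplex_notMem (i : Fin N) : F.simplex i ∉ (F.complex i.castSucc).faces := by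
  have : F.simplex i ∈ (F.complex i.succ).faces \ (F.complex i.castSucc).faces := by
    rw [F.faces_diff]
    rfl
  exact this.2

theorem simplex_injective : Function.Injective F.simplex := by
  have key : ∀ i j : Fin N, i < j → F.simplex i ≠ F.simplex j := fun i j hij h => by
    refine F.simplex_notMem j (F.faces_mono ?_ (h ▸ F.simplex_mem i))
    exact Fin.le_def.2 (by simpa using hij)
  intro i j h
  rcases lt_trichotomy i j with hij | rfl | hij
  · exact absurd h (key i j hij)
  · rfl
  · exact absurd h.symm (key j i hij)

theorem exists_simplex_eq {a : Fin (N + 1)} {σ : Finset V} (h : σ ∈ (F.complex a).faces) :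
    ∃ i : Fin N, i.castSucc < a ∧ F.simplex i = σ := by
  induction a using Fin.induction with
  | zero => simp [F.faces_zero] at h
  | succ j ih =>
    by_cases hσ : σ ∈ (F.complex j.castSucc).faces
    · obtain ⟨i, hi, h⟩ := ih hσ
      exact ⟨i, hi.trans (Fin.castSucc_lt_succ), h⟩
    · have : σ ∈ (F.complex j.succ).faces \ (F.complex j.castSucc).faces := ⟨h, hσ⟩
      rw [F.faces_diff] at this
      exact ⟨j, Fin.castSucc_lt_succ, (Set.mem_singleton_iff.1 this).symm⟩

theorem simplex_nonempty (i : Fin N) : (F.simplex i).Nonempty :=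
  ((F.complex i.succ).isRelLowerSet_faces (F.simplex_mem i)).1

theorem exists_simplex_eq_of_subset {j : Fin N} {σ : Finset V} (hσ : σ.Nonempty)
    (h : σ ⊆ F.simplex j) : ∃ i, i ≤ j ∧ F.simplex i = σ := by
  obtain ⟨i, hi, h⟩ := F.exists_simplex_eq
    (((F.complex j.succ).isRelLowerSet_faces (F.simplex_mem j)).2 h hσ)
  exact ⟨i, Fin.le_def.2 (by simpa [Fin.lt_def, Nat.lt_succ_iff] using hi), h⟩

variable [DecidableEq V]

theorem boundaryMatrix_ne_zero_iff {i j : Fin N} : F.boundaryMatrix i j ≠ 0 ↔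
    F.simplex i ⊆ F.simplex j ∧ (F.simplex j).card = (F.simplex i).card + 1 := by
  simp [boundaryMatrix]

theorem lt_of_boundaryMatrix_ne_zero (i j : Fin N) (h : F.boundaryMatrix i j ≠ 0) : i < j := by
  rw [boundaryMatrix_ne_zero_iff] at h
  obtain ⟨k, hk, hki⟩ := F.exists_simplex_eq_of_subset (F.simplex_nonempty i) h.1
  rw [F.simplex_injective hki] at hk
  refine lt_of_le_of_ne hk ?_
  rintro rfl
  omega

theorem colSize_boundaryMatrix_le (j : Fin N) : colSize F.boundaryMatrix j ≤ F.dim j + 1 := by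
  have hpos := (F.simplex_nonempty j).card_pos
  have hc : F.dim j + 1 = ((F.simplex j).powersetCard ((F.simplex j).card - 1)).card := by
    rw [Finset.card_powersetCard, dim]
    obtain ⟨c, hc⟩ := Nat.exists_eq_succ_of_ne_zero hpos.ne'
    simp [hc]
  rw [hc]
  refine Finset.card_le_card_of_injOn F.simplex (fun i hi => ?_) F.simplex_injective.injOn
  have := F.boundaryMatrix_ne_zero_iff.1 (Finset.mem_filter.1 (Finset.mem_coe.1 hi)).2
  exact Finset.mem_coe.2 (Finset.mem_powersetCard.2 ⟨this.1, by omega⟩)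

/-- A face of codimension two lies in exactly two facets of a simplex, both present in the
filtration, and `2 = 0`. -/
theorem boundaryMatrix_mul_self : F.boundaryMatrix * F.boundaryMatrix = 0 := by
  ext i k
  rw [Matrix.mul_apply, Matrix.zero_apply]
  have hterm : ∀ j, F.boundaryMatrix i j * F.boundaryMatrix j k =
      if (F.simplex i ⊆ F.simplex j ∧ (F.simplex j).card = (F.simplex i).card + 1) ∧
        (F.simplex j ⊆ F.simplex k ∧ (F.simplex k).card = (F.simplex j).card + 1)
      then 1 else 0 := fun j => by
    simp only [boundaryMatrix, Matrix.of_apply, ← ite_and, mul_ite, mul_one, mul_zero]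
    congr 1
    simp only [eq_iff_iff]
    tauto
  simp only [hterm]
  rw [Finset.sum_boole]
  by_cases hik : F.simplex i ⊆ F.simplex k ∧ (F.simplex k).card = (F.simplex i).card + 2
  · obtain ⟨hsub, hcard⟩ := hik
    have hdiff : (F.simplex k \ F.simplex i).card = 2 := by
      rw [Finset.card_sdiff_of_subset hsub]
      omega
    obtain ⟨a, b, hab, hkab⟩ := Finset.card_eq_two.1 hdiff
    have hmem : ∀ x, x ∈ F.simplex k ∧ x ∉ F.simplex i ↔ x = a ∨ x = b := fun x => by
      rw [← Finset.mem_sdiff, hkab]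
      simp
    have hins : ∀ x, x ∈ F.simplex k ∧ x ∉ F.simplex i →
        ∃ j, F.simplex j = insert x (F.simplex i) := fun x hx => by
      obtain ⟨j, -, hj⟩ := F.exists_simplex_eq_of_subset (σ := insert x (F.simplex i)) (by simp)
        (Finset.insert_subset hx.1 hsub)
      exact ⟨j, hj⟩
    have ha := (hmem a).2 (Or.inl rfl)
    have hb := (hmem b).2 (Or.inr rfl)
    obtain ⟨ja, hja⟩ := hins a ha
    obtain ⟨jb, hjb⟩ := hins b hb
    have hne : ja ≠ jb := by
      rintro rfl
      have : a ∈ insert b (F.simplex i) := by rw [← hjb, hja]; simp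
      simp [hab, ha.2] at this
    have hset : (Finset.univ.filter fun j =>
        (F.simplex i ⊆ F.simplex j ∧ (F.simplex j).card = (F.simplex i).card + 1) ∧
        (F.simplex j ⊆ F.simplex k ∧ (F.simplex k).card = (F.simplex j).card + 1)) =
        {ja, jb} := by
      ext j
      simp only [Finset.mem_filter, Finset.mem_univ, true_and, Finset.mem_insert,
        Finset.mem_singleton]
      constructor
      · rintro ⟨⟨hij, hcij⟩, hjk, -⟩
        obtain ⟨x, hx, hxj⟩ := (Finset.covBy_iff_exists_insert).1
          (Finset.covBy_iff_card_sdiff_eq_one.2 ⟨hij, by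
            rw [Finset.card_sdiff_of_subset hij]; omega⟩)
        rcases (hmem x).1 ⟨hjk (hxj ▸ Finset.mem_insert_self _ _), hx⟩ with rfl | rfl
        · exact Or.inl (F.simplex_injective (by rw [hja, hxj]))
        · exact Or.inr (F.simplex_injective (by rw [hjb, hxj]))
      · rintro (rfl | rfl)
        · rw [hja, Finset.card_insert_of_notMem ha.2]
          exact ⟨⟨Finset.subset_insert _ _, rfl⟩, Finset.insert_subset ha.1 hsub, hcard⟩
        · rw [hjb, Finset.card_insert_of_notMem hb.2]
          exact ⟨⟨Finset.subset_insert _ _, rfl⟩, Finset.insert_subset hb.1 hsub, hcard⟩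
    rw [hset, Finset.card_pair hne]
    rfl
  · rw [Finset.filter_eq_empty_iff.2]
    · simp
    · rintro j - ⟨⟨h₁, h₂⟩, h₃, h₄⟩
      exact hik ⟨h₁.trans h₃, by omega⟩

end SimplexwiseFiltration

theorem mainTheorem2 {V : Type*} [DecidableEq V] {N : ℕ} (F : SimplexwiseFiltration V N)
    (R : Matrix (Fin N) (Fin N) (ZMod 2)) (hR : IsReductionOf F.boundaryMatrix R) :
    (∃ s : Retrospective.State N, Retrospective.Main F.boundaryMatrix s) ∧
    ∀ s : Retrospective.State N, Retrospective.Main F.boundaryMatrix s →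
      (s.bitflips : ℤ) ≤
        ∑ p ∈ extendedPairs R, (((p.2 : ℕ) : ℤ) - ((p.1 : ℕ) : ℤ)) ^ 2 +
          ∑ k : Fin N, ((F.dim k : ℤ) + 1) := by
  have hD := F.boundaryMatrix_mul_self
  have hup := F.lt_of_boundaryMatrix_ne_zero
  refine ⟨Retrospective.exists_main hD hR hup, fun s hs => ?_⟩
  refine (Nat.cast_le.2 (hs.bitflips_le hD hR hup)).trans
    ((Retrospective.sum_additionCost_le _ hR.2).trans (add_le_add le_rfl ?_))
  exact Finset.sum_le_sum fun k _ => by exact_mod_cast F.colSize_boundaryMatrix_le k
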